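/- Let $V$ be a finite set of vertices, partitioned as $V = V_1 \sqcup V_2$ (either part may be empty), and let $E \subseteq V \times V$ be such that every vertex has at least one successor. A play from $v \in V$ is an infinite sequence $\pi = \pi_0\pi_1\cdots \in V^\omega$ with $\pi_0 = v$ and $(\pi_k,\pi_{k+1}) \in E$ for all $k$; $\mathsf{Plays}(v)$ is the set of plays from $v$. For $i \in \{1,2\}$, a strategy of player $i$ is a map $\sigma_i : V^*V_i \to V$ sending every $hu$, with $h \in V^*$ and $u \in V_i$, to a successor of $u$; $\Gamma_i$ is the set of these strategies, and $\mathsf{Plays}_{\sigma_i}(v)$ is the set of all $\pi \in \mathsf{Plays}(v)$ with $\pi_{k+1} = \sigma_i(\pi_0\cdots\pi_k)$ whenever $\pi_k \in V_i$. Let $\ltimes \subseteq V^\omega \times V^\omega$ be an $\omega$-automatic relation, i.e. there is a deterministic parity automaton with finitely many states over the alphabet $V \times V$ that accepts a word $(x_0,y_0)(x_1,y_1)\cdots$ (the maximum priority seen infinitely often along its run is even) if and only if $x \ltimes y$. For $v \in V$ put $$\mathsf{Val}_1(v) = \{\pi \in \mathsf{Plays}(v) \mid \exists \sigma_1 \in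 \Gamma_1\ \forall \rho \in \mathsf{Plays}_{\sigma_1}(v) : \pi \ltimes \rho\},$$ $$\mathsf{Val}_2(v) = \{\pi \in \mathsf{Plays}(v) \mid \exists \sigma_2 \in \Gamma_2\ \forall \rho \in \mathsf{Plays}_{\sigma_2}(v) : \pi \not\ltimes \rho\}.$$ Then, for every $v \in V$, $$\mathsf{Val}_1(v) = \mathsf{Plays}(v) \setminus \mathsf{Val}_2(v).$$ -/

import Mathlib

namespace AutomaticGames

/-- A deterministic parity automaton on infinite words, with states `Q`, alphabet `S` and
priorities on the states. -/
structure DPW (Q S : Type*) where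
  start : Q
  step : Q → S → Q
  priority : Q → ℕ

/-- The run of the automaton on the infinite word `w`: `M.run w n` is the state reached after
reading the first `n` letters. -/
def DPW.run {Q S : Type*} (M : DPW Q S) (w : ℕ → S) : ℕ → Q
  | 0 => M.start
  | n + 1 => M.step (M.run w n) (w n)

/-- Acceptance: the maximum priority seen infinitely often along the run is even. -/
def DPW.Accepts {Q S : Type*} (M : DPW Q S) (w : ℕ → S) : Prop :=
  ∃ p, IsGreatest {c | ∃ᶠ n in Filter.atTop, M.priority (M.run w n) = c} p ∧ Even p

/-- A binary relation on infinite words over `S` is ω-automatic if a DPW with finitely many states,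
reading the two words synchronously, accepts exactly the related pairs. -/
def IsOmegaAutomatic {S : Type*} (R : (ℕ → S) → (ℕ → S) → Prop) : Prop :=
  ∃ (Q : Type) (_ : Finite Q) (M : DPW Q (S × S)),
    ∀ x y : ℕ → S, R x y ↔ M.Accepts (fun n => (x n, y n))

/-- An arena with vertices `V` and players `P`. The partition of the vertices among the
players is given by `owner`; every vertex has a successor. -/
structure Arena (V P : Type*) where
  edge : V → V → Prop
  owner : V → P
  exists_succ : ∀ v, ∃ w, edge v w

/-- The plays that start at `v`. -/
def Arena.plays {V P : Type*} (A : Arena V P) (v : V) : Set (ℕ → V) :=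
  {π | π 0 = v ∧ ∀ k, A.edge (π k) (π (k + 1))}

/-- A strategy of player `i`, a map from `V^* V_i` to `V`: `next h v` is the successor of `v`
chosen after the history `hv`. -/
structure Arena.Strategy {V P : Type*} (A : Arena V P) (i : P) where
  next : List V → {v : V // A.owner v = i} → V
  next_edge : ∀ (h : List V) (v : {v : V // A.owner v = i}), A.edge v.1 (next h v)

/-- The plays that start at `v` and are consistent with the strategy `σ`. -/
def Arena.Strategy.plays {V P : Type*} {A : Arena V P} {i : P} (σ : A.Strategy i) (v : V) :
    Set (ℕ → V) :=
  {π | π ∈ A.plays v ∧ ∀ (k : ℕ) (hk : A.owner (π k) = i),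
    π (k + 1) = σ.next (List.ofFn fun j : Fin k => π j) ⟨π k, hk⟩}

/-- The value of `v` for player `i` whose preference relation is `R`: the plays `π` from `v`
such that player `i` has a strategy all of whose consistent plays `ρ` from `v` satisfy
`R π ρ`. -/
def Arena.value {V P : Type*} (A : Arena V P) (i : P) (R : (ℕ → V) → (ℕ → V) → Prop) (v : V) :
    Set (ℕ → V) :=
  {π | π ∈ A.plays v ∧ ∃ σ : A.Strategy i, ∀ ρ ∈ σ.plays v, R π ρ}

/-- The two players. -/
inductive Player
  | one
  | two

/-- A two-player zero-sum game with an ω-automatic preference relation `pref` for player 1;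
the preference relation of player 2 is the complement of `pref`. -/
structure ZeroSumGame (V : Type*) where
  arena : Arena V Player
  pref : (ℕ → V) → (ℕ → V) → Prop
  pref_automatic : IsOmegaAutomatic pref

/-- The value of `v` for player 1. -/
def ZeroSumGame.val₁ {V : Type*} (G : ZeroSumGame V) (v : V) : Set (ℕ → V) :=
  G.arena.value Player.one G.pref v

/-- The value of `v` for player 2. -/
def ZeroSumGame.val₂ {V : Type*} (G : ZeroSumGame V) (v : V) : Set (ℕ → V) :=
  G.arena.value Player.two (fun x y => ¬ G.pref x y) v

end AutomaticGames

/- Fix the reference play `π`. Whether `π` is related to a play `ρ` is a parity condition on the run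
of the automaton on `(π, ρ)`, so on the tree of histories player 1 wants this condition and
player 2 its complement. This is a parity game with boundedly many priorities, hence determined,
and the winner's strategy on the tree witnesses that `π` lies in exactly one of the two values.

Determinacy is by induction on the number of priorities. Let `i` be the player favoured by the top
priority `d`, let `C` be the complement of the opponent's winning region, and let `Z` be the part
of `C` from which `i` can, without leaving `C`, neither win nor force a visit to priority `d`.
Wherever the opponent wins the game played on `Z`, she wins the full game, since `i` can leave `Z`
only into her winning region. Wherever `i` wins the game played on `Z`, he wins or forces a visit
to `d` in `C`, since the opponent can leave `Z` only to positions where he does. By induction `Z` is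
empty, so in `C` player `i` forces visits to `d` again and again, unless he wins otherwise. -/

namespace AutomaticGames

open Filter Set
open scoped SetRel

/-- The graph of a game between players `P`. Unlike in an `Arena`, positions without successor are
allowed: this way the restriction of a game to a set of positions keeps the type `X`. -/
structure GameGraph (X P : Type*) where
  edge : SetRel X X
  owner : X → P

/-- Objectives that are insensitive to what happens before a play enters them: a sequence belongs
to `Φ` as soon as one of its tails does. -/
def IsTailReflecting {X : Type*} (Φ : Set (ℕ → X)) : Prop :=
  ∀ (m : ℕ) (π : ℕ → X), (fun n => π (n + m)) ∈ Φ → π ∈ Φ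

namespace GameGraph

variable {X P : Type*} {G : GameGraph X P} {p q : P} {T Z C N : Set X} {Φ Ψ : Set (ℕ → X)}

/-- The relation `S` is a positional strategy by which player `p` reaches `T` or ensures the
objective `Φ`. It may be nondeterministic, and is encoded as the set of the moves of all players
that are compatible with it; its domain is the set of positions for which it is designed. -/
structure IsStrategy (G : GameGraph X P) (p : P) (T : Set X) (Φ : Set (ℕ → X)) (S : SetRel X X) :
    Prop where
  subset_edge : S ⊆ G.edge
  disjoint : Disjoint S.dom T
  cod_subset : S.cod ⊆ S.dom ∪ T
  mem_of_owner_ne : ∀ {x y}, x ∈ S.dom → G.owner x ≠ p → x ~[G.edge] y → x ~[S] y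
  objective : ∀ π : ℕ → X, (∀ k, π k ~[S] π (k + 1)) → π ∈ Φ

/-- The positions from which player `p` can reach `T` by at least one move or ensure the
objective `Φ`, by a positional strategy. The positions of `T` itself are left out. -/
def winningRegion (G : GameGraph X P) (p : P) (T : Set X) (Φ : Set (ℕ → X)) : Set X :=
  {x | ∃ S, G.IsStrategy p T Φ S ∧ x ∈ S.dom}

/-- The game played inside the set `C` of positions. -/
def restrict (G : GameGraph X P) (C : Set X) : GameGraph X P where
  edge := G.edge ∩ C ×ˢ C
  owner := G.owner

/-- A set `C` of positions is a trap for player `p` if `p` cannot leave `C`, and the other players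
are never forced to leave it. -/
structure IsTrap (G : GameGraph X P) (p : P) (C : Set X) : Prop where
  mem_of_owner_eq : ∀ {x y}, x ∈ C → G.owner x = p → x ~[G.edge] y → y ∈ C
  exists_mem : ∀ {x}, x ∈ C → x ∈ G.edge.dom → ∃ y ∈ C, x ~[G.edge] y

theorem IsStrategy.notMem {S : SetRel X X} (hS : G.IsStrategy p T Φ S) {x : X} (hx : x ∈ S.dom) :
    x ∉ T :=
  hS.disjoint.notMem_of_mem_left hx

theorem IsStrategy.mem_dom_or {S : SetRel X X} (hS : G.IsStrategy p T Φ S) {x y : X}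
    (hxy : x ~[S] y) : y ∈ S.dom ∨ y ∈ T :=
  hS.cod_subset ⟨x, hxy⟩

theorem IsStrategy.mem_objective_of_follows {S : SetRel X X} (hS : G.IsStrategy p T Φ S)
    {π : ℕ → X} (h₀ : π 0 ∈ S.dom) (hT : ∀ k, π k ∉ T)
    (hπ : ∀ k, π k ∈ S.dom → π k ~[S] π (k + 1)) : π ∈ Φ := by
  have hdom : ∀ k, π k ∈ S.dom := fun k => by
    induction k with
    | zero => exact h₀
    | succ k ih => exact (hS.mem_dom_or (hπ k ih)).resolve_right (hT _)
  exact hS.objective π fun k => hπ k (hdom k)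

theorem winningRegion_mono_objective
    (h : ∀ π ∈ Φ, (∀ k, π k ~[G.edge] π (k + 1)) → π ∈ Ψ) :
    G.winningRegion p T Φ ⊆ G.winningRegion p T Ψ := by
  rintro x ⟨S, hS, hx⟩
  refine ⟨S, { hS with objective := fun π hπ => ?_ }, hx⟩
  exact h π (hS.objective π hπ) fun k => hS.subset_edge (hπ k)

/-- Well-order the indices and follow at each position the least strategy that is defined there.
Along a play the index of this strategy decreases, so it is eventually constant. -/
theorem exists_isStrategy_dom_eq_iUnion {ι : Type*} {S : ι → SetRel X X}
    (hΦ : IsTailReflecting Φ) (hS : ∀ i, G.IsStrategy p T Φ (S i)) :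
    ∃ R, G.IsStrategy p T Φ R ∧ R.dom = ⋃ i, (S i).dom := by
  obtain ⟨_, _⟩ := exists_wellFoundedLT ι
  let R : SetRel X X := {e | ∃ i, IsLeast {i | e.1 ∈ (S i).dom} i ∧ e ∈ S i}
  have mem_dom_R (i : ι) {x : X} (hx : x ∈ (S i).dom) : x ∈ R.dom := by
    obtain ⟨j, hj⟩ := exists_minimal_of_wellFoundedLT (fun j => x ∈ (S j).dom) ⟨i, hx⟩
    obtain ⟨y, hy⟩ := hj.prop
    exact ⟨y, j, minimal_iff_isLeast.1 hj, hy⟩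
  refine ⟨R, ⟨?_, ?_, ?_, ?_, fun π hπ => ?_⟩, ?_⟩
  · rintro e ⟨i, -, he⟩
    exact (hS i).subset_edge he
  · rw [disjoint_left]
    rintro x ⟨y, i, -, hxy⟩
    exact (hS i).notMem ⟨y, hxy⟩
  · rintro y ⟨x, i, -, hxy⟩
    exact ((hS i).mem_dom_or hxy).imp_left (mem_dom_R i)
  · rintro x y ⟨z, i, hi, hxz⟩ hxp hxy
    exact ⟨i, hi, (hS i).mem_of_owner_ne ⟨z, hxz⟩ hxp hxy⟩
  · choose i hleast hi using hπ
    have hanti : Antitone i := antitone_nat_of_succ_le fun k =>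
      (hleast (k + 1)).2 <| ((hS (i k)).mem_dom_or (hi k)).resolve_right <|
        (hS (i (k + 1))).notMem ⟨_, hi (k + 1)⟩
    obtain ⟨m, hm⟩ := WellFoundedLT.antitone_chain_condition hanti
    refine hΦ m π ((hS (i m)).objective _ fun k => ?_)
    rw [hm (k + m) (Nat.le_add_left m k), Nat.add_right_comm]
    exact hi (k + m)
  · refine Subset.antisymm ?_ (iUnion_subset fun i x => mem_dom_R i)
    rintro x ⟨y, i, -, hxy⟩
    exact mem_iUnion.2 ⟨i, y, hxy⟩

theorem exists_isStrategy_dom_eq_winningRegion (hΦ : IsTailReflecting Φ) :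
    ∃ S, G.IsStrategy p T Φ S ∧ S.dom = G.winningRegion p T Φ := by
  obtain ⟨S, hS, hdom⟩ := exists_isStrategy_dom_eq_iUnion hΦ
    fun R : {R // G.IsStrategy p T Φ R} => R.2
  refine ⟨S, hS, hdom.trans ?_⟩
  ext x
  simp only [winningRegion, mem_iUnion, Subtype.exists, exists_prop, mem_ofPred_eq]

theorem IsStrategy.union {S S' : SetRel X X} (hΦ : IsTailReflecting Φ)
    (hS : G.IsStrategy p T Φ S) (hS' : G.IsStrategy p (T ∪ S.dom) Φ S') :
    G.IsStrategy p T Φ (S ∪ S') := by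
  have hST {x : X} (hx : x ∈ (S ∪ S').dom) : x ∉ T := by
    obtain ⟨y, hxy | hxy⟩ := hx
    · exact hS.notMem ⟨y, hxy⟩
    · exact fun hxT => hS'.notMem ⟨y, hxy⟩ (Or.inl hxT)
  have mem_S {x y : X} (hx : x ∈ S.dom) (hxy : x ~[S ∪ S'] y) : x ~[S] y :=
    hxy.resolve_right fun h => hS'.notMem ⟨y, h⟩ (Or.inr hx)
  refine ⟨union_subset hS.subset_edge hS'.subset_edge, disjoint_left.2 fun _ => hST, ?_, ?_, ?_⟩
  · have hdom : S.dom ⊆ (S ∪ S').dom := SetRel.dom_mono subset_union_left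
    have hdom' : S'.dom ⊆ (S ∪ S').dom := SetRel.dom_mono subset_union_right
    rintro y ⟨x, hxy | hxy⟩
    · exact (hS.mem_dom_or hxy).imp_left (@hdom y)
    · rcases hS'.mem_dom_or hxy with hy | hy | hy
      exacts [Or.inl (hdom' hy), Or.inr hy, Or.inl (hdom hy)]
  · rintro x y ⟨z, hxz | hxz⟩ hxp hxy
    · exact Or.inl (hS.mem_of_owner_ne ⟨z, hxz⟩ hxp hxy)
    · exact Or.inr (hS'.mem_of_owner_ne ⟨z, hxz⟩ hxp hxy)
  · intro π hπ
    by_cases hmeet : ∃ m, π m ∈ S.dom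
    · obtain ⟨m, hm⟩ := hmeet
      refine hΦ m π (hS.mem_objective_of_follows (by rwa [Nat.zero_add])
        (fun k => hST ⟨_, hπ (k + m)⟩) fun k hk => ?_)
      rw [Nat.add_right_comm]
      exact mem_S hk (hπ (k + m))
    · exact hS'.objective π fun k => (hπ k).resolve_left fun h => hmeet ⟨k, _, h⟩

theorem winningRegion_union_winningRegion_subset (hΦ : IsTailReflecting Φ) :
    G.winningRegion p (T ∪ G.winningRegion p T Φ) Φ ⊆ G.winningRegion p T Φ := by
  obtain ⟨S, hS, hdom⟩ := exists_isStrategy_dom_eq_winningRegion (G := G) (p := p) (T := T) hΦ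
  rw [← hdom]
  rintro x ⟨S', hS', y, hxy⟩
  rw [hdom]
  exact ⟨S ∪ S', hS.union hΦ hS', y, Or.inr hxy⟩

theorem mem_winningRegion_of_edge {x y : X} (hx : x ∉ T)
    (hforced : G.owner x ≠ p → ∀ z, x ~[G.edge] z → z ∈ T) (hxy : x ~[G.edge] y) (hy : y ∈ T) :
    x ∈ G.winningRegion p T Φ := by
  refine ⟨{e | e.1 = x ∧ e ∈ G.edge ∧ e.2 ∈ T}, ⟨fun e he => he.2.1, ?_, ?_, ?_, ?_⟩,
    y, rfl, hxy, hy⟩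
  · rw [disjoint_left]
    rintro _ ⟨_, rfl, -⟩
    exact hx
  · rintro z ⟨_, -, -, hz⟩
    exact Or.inr hz
  · rintro _ z ⟨_, rfl, -⟩ hxp hxz
    exact ⟨rfl, hxz, hforced hxp z hxz⟩
  · intro π hπ
    have hπ₁ : π 1 = x := (hπ 1).1
    exact absurd (hπ 0).2.2 (hπ₁ ▸ hx)

theorem isTrap_compl_winningRegion (hΦ : IsTailReflecting Φ) :
    G.IsTrap p (T ∪ G.winningRegion p T Φ)ᶜ := by
  set A := T ∪ G.winningRegion p T Φ
  have hA {x y : X} (hx : x ∉ A) (hxy : x ~[G.edge] y) (hy : y ∈ A) :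
      ¬ (G.owner x ≠ p → ∀ z, x ~[G.edge] z → z ∈ A) := fun hforced =>
    hx (Or.inr (winningRegion_union_winningRegion_subset hΦ
      (mem_winningRegion_of_edge hx hforced hxy hy)))
  constructor
  · intro x y hx hxp hxy hy
    exact hA hx hxy hy fun h => absurd hxp h
  · rintro x hx ⟨y, hxy⟩
    by_contra! hall
    have hsucc (z : X) (hxz : x ~[G.edge] z) : z ∈ A := not_not.1 fun hz => hall z hz hxz
    exact hA hx hxy (hsucc y hxy) fun _ => hsucc

theorem IsTrap.dom_restrict (hC : G.IsTrap p C) : (G.restrict C).edge.dom = G.edge.dom ∩ C := by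
  ext x
  constructor
  · rintro ⟨y, hxy, hx, -⟩
    exact ⟨⟨y, hxy⟩, hx⟩
  · rintro ⟨hdom, hx⟩
    obtain ⟨y, hy, hxy⟩ := hC.exists_mem hx hdom
    exact ⟨y, hxy, hx, hy⟩

theorem IsTrap.cod_subset_dom_restrict (hC : G.IsTrap p C) (hG : G.edge.cod ⊆ G.edge.dom) :
    (G.restrict C).edge.cod ⊆ (G.restrict C).edge.dom := by
  rw [hC.dom_restrict]
  rintro y ⟨x, hxy, -, hy⟩
  exact ⟨hG ⟨x, hxy⟩, hy⟩

theorem restrict_restrict : (G.restrict C).restrict Z = G.restrict (C ∩ Z) := by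
  simp only [restrict, inter_assoc, prod_inter_prod]

theorem winningRegion_restrict_subset (hZT : Disjoint Z T)
    (hleave : ∀ x ∈ Z, G.owner x ≠ p → ∀ y, x ~[G.edge] y → y ∈ Z ∪ T) :
    (G.restrict Z).winningRegion p ∅ Φ ⊆ G.winningRegion p T Φ := by
  rintro x ⟨S, hS, y, hxy⟩
  let L : SetRel X X := {e | e ∈ G.edge ∧ e.1 ∈ S.dom ∧ G.owner e.1 ≠ p ∧ e.2 ∈ T}
  have hSZ : S.dom ⊆ Z := fun _ ⟨_, h⟩ => (hS.subset_edge h).2.1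
  have hdom : (S ∪ L).dom ⊆ S.dom := by
    rintro a ⟨b, h | h⟩
    exacts [⟨b, h⟩, h.2.1]
  refine ⟨S ∪ L, ⟨?_, hZT.mono_left (hdom.trans hSZ), ?_, ?_, fun π hπ => ?_⟩, y, Or.inl hxy⟩
  · exact union_subset (fun e he => (hS.subset_edge he).1) fun e he => he.1
  · rintro b ⟨a, hab | hab⟩
    · exact Or.inl (SetRel.dom_mono subset_union_left ((hS.mem_dom_or hab).resolve_right id))
    · exact Or.inr hab.2.2.2
  · intro a b ha hap hab
    refine (hleave a (hSZ (hdom ha)) hap b hab).imp (fun hb => ?_) fun hb => ⟨hab, hdom ha, hap, hb⟩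
    exact hS.mem_of_owner_ne (hdom ha) hap ⟨hab, hSZ (hdom ha), hb⟩
  · refine hS.objective π fun k => (hπ k).resolve_right fun h => ?_
    exact hZT.notMem_of_mem_left (hSZ (hdom ⟨_, hπ (k + 1)⟩)) h.2.2.2

theorem winningRegion_restrict_eq_empty (hΦ : IsTailReflecting Φ)
    (hZ : Disjoint Z (T ∪ G.winningRegion p T Φ))
    (hleave : ∀ x ∈ Z, G.owner x ≠ p → ∀ y, x ~[G.edge] y → y ∈ Z ∪ (T ∪ G.winningRegion p T Φ)) :
    (G.restrict Z).winningRegion p ∅ Φ = ∅ := by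
  refine eq_empty_of_forall_notMem fun x hx => hZ.notMem_of_mem_left (a := x) ?_ (Or.inr ?_)
  · obtain ⟨S, hS, y, hxy⟩ := hx
    exact (hS.subset_edge hxy).2.1
  · exact winningRegion_union_winningRegion_subset hΦ (winningRegion_restrict_subset hZ hleave hx)

theorem dom_subset_winningRegion_recurrence (hΦ : IsTailReflecting Φ)
    (hG : G.edge.cod ⊆ G.edge.dom) (hN : G.edge.dom ⊆ N ∪ G.winningRegion p N Φ) :
    G.edge.dom ⊆ G.winningRegion p ∅ ({π | ∃ᶠ n in atTop, π n ∈ N} ∪ Φ) := by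
  obtain ⟨S, hS, hdom⟩ := exists_isStrategy_dom_eq_winningRegion (G := G) (p := p) (T := N) hΦ
  rw [← hdom] at hN
  let F : SetRel X X := S ∪ {e ∈ G.edge | e.1 ∈ N}
  have hF : F ⊆ G.edge := union_subset hS.subset_edge fun e he => he.1
  have hdomF : G.edge.dom ⊆ F.dom := by
    rintro x ⟨y, hxy⟩
    rcases hN ⟨y, hxy⟩ with hx | ⟨z, hxz⟩
    exacts [⟨y, Or.inr ⟨hxy, hx⟩⟩, ⟨z, Or.inl hxz⟩]
  refine fun x hx => ⟨F, ⟨hF, disjoint_empty _, ?_, ?_, fun π hπ => ?_⟩, hdomF hx⟩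
  · exact (((SetRel.cod_mono hF).trans hG).trans hdomF).trans subset_union_left
  · rintro a b ⟨c, hac | hac⟩ hap hab
    · exact Or.inl (hS.mem_of_owner_ne ⟨c, hac⟩ hap hab)
    · exact Or.inr ⟨hab, hac.2⟩
  · refine or_iff_not_imp_left.2 fun hfin => ?_
    obtain ⟨m, hm⟩ := eventually_atTop.1 (not_frequently.1 hfin)
    refine hΦ m π (hS.objective _ fun k => ?_)
    rw [Nat.add_right_comm]
    exact (hπ (k + m)).resolve_right fun h => hm _ (Nat.le_add_left m k) h.2

end GameGraph

section ParityGames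

variable {X : Type*} {prio : X → ℕ} {p : Player} {d : ℕ}

/-- The opponent of a player. -/
def Player.opponent : Player → Player
  | one => two
  | two => one

theorem Player.eq_or_eq_opponent (p q : Player) : q = p ∨ q = p.opponent := by
  cases p <;> cases q <;> simp only [Player.opponent, reduceCtorEq, or_true, true_or]

/-- The player who wins a play in which `c` is the maximum priority seen infinitely often. -/
def favouredPlayer (c : ℕ) : Player := if Even c then .one else .two

/-- The parity objective of player `p`. A play in which there is no maximum among the priorities
seen infinitely often is won by nobody. -/
def parityObjective (prio : X → ℕ) (p : Player) : Set (ℕ → X) :=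
  {π | ∃ c, IsGreatest {c | ∃ᶠ n in atTop, prio (π n) = c} c ∧ favouredPlayer c = p}

theorem isTailReflecting_parityObjective : IsTailReflecting (parityObjective prio p) := by
  intro m π h
  have hfreq (c : ℕ) :
      (∃ᶠ n in atTop, prio (π (n + m)) = c) ↔ ∃ᶠ n in atTop, prio (π n) = c := by
    conv_rhs => rw [← map_add_atTop_eq_nat m, frequently_map]
  simpa only [parityObjective, mem_ofPred_eq, hfreq] using h

theorem mem_parityObjective_of_frequently {π : ℕ → X} (hle : ∀ n, prio (π n) ≤ d)
    (hd : ∃ᶠ n in atTop, prio (π n) = d) : π ∈ parityObjective prio (favouredPlayer d) := by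
  refine ⟨d, ⟨hd, fun c hc => ?_⟩, rfl⟩
  obtain ⟨n, rfl⟩ := hc.exists
  exact hle n

namespace GameGraph

variable {G : GameGraph X Player}

theorem IsTrap.winningRegion_restrict_subset {C : Set X} {Φ : Set (ℕ → X)}
    (hC : G.IsTrap p.opponent C) :
    (G.restrict C).winningRegion p ∅ Φ ⊆ G.winningRegion p ∅ Φ :=
  GameGraph.winningRegion_restrict_subset (disjoint_empty C) fun x hx hxp _ hxy =>
    Or.inl (hC.mem_of_owner_eq hx ((p.eq_or_eq_opponent (G.owner x)).resolve_left hxp) hxy)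

theorem dom_subset_winningRegion_favouredPlayer (hG : G.edge.cod ⊆ G.edge.dom)
    (hd : ∀ x ∈ G.edge.dom, prio x ≤ d)
    (hN : G.edge.dom ⊆ {x | prio x = d} ∪ G.winningRegion (favouredPlayer d) {x | prio x = d}
      (parityObjective prio (favouredPlayer d))) :
    G.edge.dom ⊆ G.winningRegion (favouredPlayer d) ∅
      (parityObjective prio (favouredPlayer d)) := by
  refine (dom_subset_winningRegion_recurrence isTailReflecting_parityObjective hG hN).trans ?_
  refine winningRegion_mono_objective fun π hπ hedge => hπ.elim (fun hfreq => ?_) id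
  exact mem_parityObjective_of_frequently (fun n => hd _ ⟨_, hedge n⟩) hfreq

theorem IsTrap.winningRegion_opponent_restrict_eq_empty {Z : Set X}
    {Φ : Set (ℕ → X)} (hΦ : IsTailReflecting Φ)
    (hZ : (G.restrict (G.winningRegion p.opponent ∅ Φ)ᶜ).IsTrap p Z) :
    ((G.restrict (G.winningRegion p.opponent ∅ Φ)ᶜ).restrict Z).winningRegion p.opponent ∅ Φ =
      ∅ := by
  set W := G.winningRegion p.opponent ∅ Φ with hW
  rw [restrict_restrict]
  refine winningRegion_restrict_eq_empty (T := ∅) hΦ ?_ fun x hx hxp y hxy => ?_ <;>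
    rw [empty_union, ← hW]
  · exact disjoint_compl_left.mono_left inter_subset_left
  · have hxp' : G.owner x = p := (p.eq_or_eq_opponent _).resolve_right hxp
    exact (em (y ∈ W)).symm.imp_left fun hy =>
      ⟨hy, hZ.mem_of_owner_eq hx.2 hxp' ⟨hxy, hx.1, hy⟩⟩

theorem dom_subset_iUnion_winningRegion_of_le (hG : G.edge.cod ⊆ G.edge.dom)
    (hd : ∀ x ∈ G.edge.dom, prio x ≤ d)
    (ih : ∀ G' : GameGraph X Player, G'.edge.cod ⊆ G'.edge.dom → (∀ x ∈ G'.edge.dom, prio x < d) →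
      G'.edge.dom ⊆ ⋃ p, G'.winningRegion p ∅ (parityObjective prio p)) :
    G.edge.dom ⊆ ⋃ p, G.winningRegion p ∅ (parityObjective prio p) := by
  have hΦ (p : Player) := isTailReflecting_parityObjective (prio := prio) (p := p)
  set i := favouredPlayer d
  set W := G.winningRegion i.opponent ∅ (parityObjective prio i.opponent)
  have hW : G.IsTrap i.opponent Wᶜ := by
    simpa only [empty_union] using isTrap_compl_winningRegion (T := ∅) (hΦ i.opponent)
  set G₁ := G.restrict Wᶜ
  have hG₁ : G₁.edge.cod ⊆ G₁.edge.dom := hW.cod_subset_dom_restrict hG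
  have hdom₁ : G₁.edge.dom = G.edge.dom ∩ Wᶜ := hW.dom_restrict
  have hd₁ : ∀ x ∈ G₁.edge.dom, prio x ≤ d := fun x hx => hd x (hdom₁ ▸ hx).1
  set A := {x | prio x = d} ∪ G₁.winningRegion i {x | prio x = d} (parityObjective prio i)
  have hA : G₁.IsTrap i Aᶜ := isTrap_compl_winningRegion (hΦ i)
  set G₂ := G₁.restrict Aᶜ
  have hdom₂ : G₂.edge.dom = G₁.edge.dom ∩ Aᶜ := hA.dom_restrict
  have hd₂ : ∀ x ∈ G₂.edge.dom, prio x < d := fun x hx => by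
    rw [hdom₂] at hx
    exact lt_of_le_of_ne (hd₁ x hx.1) fun h => hx.2 (Or.inl h)
  have hempty (p : Player) : G₂.winningRegion p ∅ (parityObjective prio p) = ∅ := by
    rcases i.eq_or_eq_opponent p with rfl | rfl
    · exact winningRegion_restrict_eq_empty (hΦ i) disjoint_compl_left
        fun _ _ _ y _ => (em (y ∈ A)).symm
    · exact hA.winningRegion_opponent_restrict_eq_empty (hΦ i.opponent)
  have hsub : G₁.edge.dom ⊆ A := by
    have hnone := ih G₂ (hA.cod_subset_dom_restrict hG₁) hd₂
    simp only [hempty, iUnion_empty, hdom₂] at hnone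
    exact fun x hx => not_not.1 fun hxA => hnone ⟨hx, hxA⟩
  intro x hx
  by_cases hxW : x ∈ W
  · exact mem_iUnion.2 ⟨i.opponent, hxW⟩
  · refine mem_iUnion.2 ⟨i, hW.winningRegion_restrict_subset ?_⟩
    exact dom_subset_winningRegion_favouredPlayer hG₁ hd₁ hsub (hdom₁ ▸ ⟨hx, hxW⟩)

theorem dom_subset_iUnion_winningRegion (hG : G.edge.cod ⊆ G.edge.dom)
    (hd : ∀ x ∈ G.edge.dom, prio x < d) :
    G.edge.dom ⊆ ⋃ p, G.winningRegion p ∅ (parityObjective prio p) := by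
  induction d generalizing G with
  | zero => exact fun x hx => absurd (hd x hx) (Nat.not_lt_zero _)
  | succ d ih =>
    exact dom_subset_iUnion_winningRegion_of_le hG (fun x hx => Nat.le_of_lt_succ (hd x hx))
      fun _ => ih

end GameGraph

end ParityGames

section Unfolding

variable {V P : Type*} {p : P}

/-- The history of the play `ρ` after `n` moves, split into the first `n` vertices and the current
one, as in the argument of a strategy. -/
def history (ρ : ℕ → V) (n : ℕ) : List V × V :=
  (List.ofFn fun j : Fin n => ρ j, ρ n)

theorem history_succ_fst (ρ : ℕ → V) (n : ℕ) :
    (history ρ (n + 1)).1 = (history ρ n).1 ++ [ρ n] := by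
  simp only [history, List.ofFn_succ_last, Fin.val_castSucc, Fin.val_last]

/-- The unfolding of an arena into the tree of its histories, on which positional strategies are
arbitrary strategies of the arena. -/
def Arena.unfolding (A : Arena V P) : GameGraph (List V × V) P where
  edge := {e | e.2.1 = e.1.1 ++ [e.1.2] ∧ A.edge e.1.2 e.2.2}
  owner x := A.owner x.2

theorem Arena.mem_unfolding_dom (A : Arena V P) (x : List V × V) : x ∈ A.unfolding.edge.dom := by
  obtain ⟨w, hw⟩ := A.exists_succ x.2
  exact ⟨(x.1 ++ [x.2], w), rfl, hw⟩

theorem Arena.exists_strategy_of_mem_winningRegion {A : Arena V P} {Φ : Set (ℕ → List V × V)}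
    {v : V} (hv : ([], v) ∈ A.unfolding.winningRegion p ∅ Φ) :
    ∃ σ : A.Strategy p, ∀ ρ ∈ σ.plays v, history ρ ∈ Φ := by
  obtain ⟨S, hS, hvS⟩ := hv
  have hmove (x : List V × V) :
      ∃ w, A.edge x.2 w ∧ (x ∈ S.dom → x ~[S] (x.1 ++ [x.2], w)) := by
    by_cases hx : x ∈ S.dom
    · obtain ⟨⟨h, w⟩, hxw⟩ := hx
      obtain ⟨hh, hw⟩ : h = x.1 ++ [x.2] ∧ A.edge x.2 w := hS.subset_edge hxw
      exact ⟨w, hw, fun _ => hh ▸ hxw⟩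
    · obtain ⟨w, hw⟩ := A.exists_succ x.2
      exact ⟨w, hw, fun h => absurd h hx⟩
  choose f hf hfS using hmove
  refine ⟨⟨fun h u => f (h, u), fun h u => hf (h, u)⟩, fun ρ ⟨⟨h₀, hedge⟩, hcons⟩ => ?_⟩
  refine hS.mem_objective_of_follows (by simpa only [history, List.ofFn_zero, h₀] using hvS)
    (fun _ => notMem_empty _) fun k hk => ?_
  by_cases ho : A.owner (ρ k) = p
  · have hnext : history ρ (k + 1) = ((history ρ k).1 ++ [ρ k], f (history ρ k)) :=
      Prod.ext (history_succ_fst ρ k) (hcons k ho)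
    exact hnext ▸ hfS _ hk
  · exact hS.mem_of_owner_ne hk ho ⟨history_succ_fst ρ k, hedge k⟩

theorem Arena.exists_parity_strategy (A : Arena V Player) {prio : List V × V → ℕ}
    (hprio : BddAbove (range prio)) (v : V) :
    ∃ (p : Player) (σ : A.Strategy p), ∀ ρ ∈ σ.plays v, history ρ ∈ parityObjective prio p := by
  obtain ⟨d, hd⟩ := hprio
  have hwin := GameGraph.dom_subset_iUnion_winningRegion (G := A.unfolding) (prio := prio)
    (fun x _ => A.mem_unfolding_dom x) (fun x _ => Nat.lt_succ_of_le (hd (mem_range_self x)))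
  obtain ⟨p, hp⟩ := mem_iUnion.1 (hwin (A.mem_unfolding_dom ([], v)))
  exact ⟨p, Arena.exists_strategy_of_mem_winningRegion hp⟩

theorem Arena.exists_forall_mem_plays (A : Arena V P) (σ : ∀ i, A.Strategy i) (v : V) :
    ∃ ρ, ∀ i, ρ ∈ (σ i).plays v := by
  let move (x : List V × V) : V := (σ (A.owner x.2)).next x.1 ⟨x.2, rfl⟩
  let s (n : ℕ) : List V × V := n.rec ([], v) fun _ x => (x.1 ++ [x.2], move x)
  let ρ (n : ℕ) : V := (s n).2
  have hs (n : ℕ) : s n = history ρ n := by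
    refine Prod.ext ?_ rfl
    induction n with
    | zero => rfl
    | succ n ih => rw [history_succ_fst, ← ih]
  refine ⟨ρ, fun i => ⟨⟨rfl, fun k => (σ (A.owner (ρ k))).next_edge (s k).1 ⟨ρ k, rfl⟩⟩, ?_⟩⟩
  rintro k rfl
  exact congrArg move (hs k)

end Unfolding

section Automata

variable {Q S V : Type*}

theorem DPW.run_congr (M : DPW Q S) {w w' : ℕ → S} {n : ℕ} (h : ∀ k < n, w k = w' k) :
    M.run w n = M.run w' n := by
  induction n with
  | zero => rfl
  | succ n ih => rw [DPW.run, DPW.run, ih fun k hk => h k (hk.trans n.lt_succ_self),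
      h n n.lt_succ_self]

/-- The priority of the state that `M` reaches after reading the reference word `π` along with a
history. The current vertex of the history has not been read yet: as the default value of `getD`
it is never used. -/
def DPW.historyPriority (M : DPW Q (V × V)) (π : ℕ → V) (x : List V × V) : ℕ :=
  M.priority (M.run (fun k => (π k, x.1.getD k x.2)) x.1.length)

theorem DPW.historyPriority_history (M : DPW Q (V × V)) (π ρ : ℕ → V) (n : ℕ) :
    M.historyPriority π (history ρ n) = M.priority (M.run (fun k => (π k, ρ k)) n) := by
  simp only [historyPriority, history, List.length_ofFn]
  congr 1
  refine M.run_congr fun k hk => ?_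
  simp only [List.getD, List.getElem?_ofFn, hk, dite_true, Option.getD_some]

theorem DPW.accepts_iff_history_mem_parityObjective {M : DPW Q (V × V)} {π ρ : ℕ → V} {p : Player}
    (hρ : history ρ ∈ parityObjective (M.historyPriority π) p) :
    M.Accepts (fun n => (π n, ρ n)) ↔ p = .one := by
  obtain ⟨c, hc, rfl⟩ := hρ
  simp only [historyPriority_history] at hc
  have hfav : favouredPlayer c = .one ↔ Even c := by
    simp only [favouredPlayer, ite_eq_left_iff, reduceCtorEq, imp_false, not_not]
  rw [hfav]
  exact ⟨fun ⟨c', hc', heven⟩ => hc'.unique hc ▸ heven, fun heven => ⟨c, hc, heven⟩⟩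

end Automata

end AutomaticGames

open AutomaticGames in
theorem mainTheorem7_general {V Q : Type*} (A : Arena V Player) {R : (ℕ → V) → (ℕ → V) → Prop}
    (M : DPW Q (V × V)) (hM : BddAbove (Set.range M.priority))
    (hR : ∀ x y, R x y ↔ M.Accepts (fun n => (x n, y n))) (v : V) :
    A.value .one R v = A.plays v \ A.value .two (fun x y => ¬ R x y) v := by
  ext π
  constructor
  · rintro ⟨hπ, σ, hσ⟩
    refine ⟨hπ, fun ⟨_, τ, hτ⟩ => ?_⟩
    obtain ⟨ρ, hρ⟩ := A.exists_forall_mem_plays (fun | .one => σ | .two => τ) v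
    exact hτ ρ (hρ .two) (hσ ρ (hρ .one))
  · rintro ⟨hπ, hnot⟩
    have hprio : BddAbove (Set.range (M.historyPriority π)) :=
      hM.mono (Set.range_comp_subset_range _ M.priority)
    obtain ⟨p, σ, hσ⟩ := A.exists_parity_strategy hprio v
    have hRp (ρ) (hρ : ρ ∈ σ.plays v) : R π ρ ↔ p = .one :=
      (hR π ρ).trans (DPW.accepts_iff_history_mem_parityObjective (hσ ρ hρ))
    cases p with
    | one => exact ⟨hπ, σ, fun ρ hρ => (hRp ρ hρ).2 rfl⟩
    | two => exact absurd ⟨hπ, σ, fun ρ hρ h => Player.noConfusion ((hRp ρ hρ).1 h)⟩ hnot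

theorem mainTheorem7 {V : Type*} [Finite V] (G : AutomaticGames.ZeroSumGame V) (v : V) :
    G.val₁ v = G.arena.plays v \ G.val₂ v := by
  obtain ⟨Q, _, M, hM⟩ := G.pref_automatic
  exact mainTheorem7_general G.arena M (Set.finite_range M.priority).bddAbove hM v
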